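/- Let $n\ge 1$ and $r\ge 1$, and let $\Gamma_n=\langle a,b\mid [a^n,b]=1\rangle$. Let $$X_r=\{(A,B)\in \mathrm U(r)^2 \mid [A^n,B]=\mathrm{Id}\}/\mathrm U(r)$$ be its $\mathrm U(r)$-character variety (the quotient by simultaneous conjugation, with the quotient topology), and let $X_r^*\subset X_r$ be the subspace of classes of irreducible representations, i.e. of pairs $(A,B)$ without a common nonzero proper invariant subspace of $\mathbb C^r$. Let $\omega\colon X_r^*\to \mathrm{Sym}^r(S^1)=(S^1)^r/S_r$ send the class of $(A,B)$ to the unordered collection of the eigenvalues of $A$, counted with multiplicity. For a partition $\sigma$ of $r$, let $\mathrm{Sym}^r_\sigma(S^1)\subset\mathrm{Sym}^r(S^1)$ be the set of configurations whose distinct points have multiplicities given by the parts of $\sigma$, let $X_\sigma^*=\omega^{-1}(\mathrm{Sym}^r_\sigma(S^1))$, let $\omega_\sigma=\omega|_{X^*_\sigma}$, and let $$B_\sigma=\{\{\lambda_1,\dots,\lambda_r\}\in \mathrm{Sym}^r_\sigma(S^1)\mid \lambda_1^n=\lambda_2^n=\dots=\lambda_r^n\}.$$ Choose any $(\lambda_1,\dots,\lambda_r)\in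 (S^1)^r$ whose underlying configuration lies in $\mathrm{Sym}^r_\sigma(S^1)$, let $\mathrm{Stab}(\sigma)$ be the stabilizer of $A_\sigma=\mathrm{diag}(\lambda_1,\dots,\lambda_r)$ under conjugation by $\mathrm U(r)$, let $\mathrm{Stab}(\sigma)$ act on $\mathrm U(r)$ by conjugation, and let $\mathbf F_\sigma\subset \mathrm U(r)/\mathrm{Stab}(\sigma)$ be the subspace of classes of those $B\in\mathrm U(r)$ such that $A_\sigma$ and $B$ have no common nonzero proper invariant subspace. Then $\omega_\sigma$ takes values in $B_\sigma$, and $\omega_\sigma\colon X_\sigma^*\to B_\sigma$ is a Zariski locally trivial fiber bundle with fiber $\mathbf F_\sigma$. That is, every point of $B_\sigma$ has a neighbourhood $V\subset B_\sigma$, open both in the usual topology and in the Zariski topology induced from $\mathrm{Sym}^r(S^1)$, with a homeomorphism $\omega_\sigma^{-1}(V)\cong V\times\mathbf F_\sigma$ over $V$. Here a subset of $\mathrm{Sym}^r(S^1)$ is Zariski open if its preimage in the real algebraic variety $(S^1)^r\subset\mathbb C^r=\mathbb R^{2r}$ is Zariski open. (The fiber may be empty, in which case so is $X_\sigma^*$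 when $B_\sigma\neq\emptyset$.) -/

import Mathlib

open scoped Matrix

noncomputable section

namespace TwistedHopf

/-- The unitary group `U(r)`, with the topology it inherits from the matrices. -/
abbrev U (r : ℕ) : Type := Matrix.unitaryGroup (Fin r) ℂ

/-- The `U(r)`-representation variety of `⟨a, b | [a ^ n, b] = 1⟩`: the pairs `(A, B)` of unitary
matrices with `[A ^ n, B] = 1`. It is stable under simultaneous conjugation. -/
def RepVar (n r : ℕ) : SubMulAction (ConjAct (U r)) (U r × U r) where
  carrier := {p | p.1 ^ n * p.2 * (p.1 ^ n)⁻¹ * p.2⁻¹ = 1}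
  smul_mem' g p hp := by
    have h : p.1 ^ n * p.2 * (p.1 ^ n)⁻¹ * p.2⁻¹ = 1 := hp
    change (g • p.1) ^ n * (g • p.2) * ((g • p.1) ^ n)⁻¹ * (g • p.2)⁻¹ = 1
    rw [← smul_pow', ← smul_inv', ← smul_inv', ← smul_mul', ← smul_mul', ← smul_mul', h, smul_one]

/-- The `U(r)`-character variety: the quotient of the representation variety by conjugation, with
the quotient topology. -/
abbrev CharVar (n r : ℕ) : Type :=
  Quotient (MulAction.orbitRel (ConjAct (U r)) (RepVar n r))

/-- `ℂ ^ r` has no nonzero proper subspace that is invariant under both `A` and `B`. (A subspace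
invariant under a unitary matrix is invariant under its inverse.) -/
def IsIrreduciblePair {r : ℕ} (A B : U r) : Prop :=
  ∀ W : Submodule ℂ (Fin r → ℂ),
    (∀ v ∈ W, (A : Matrix (Fin r) (Fin r) ℂ) *ᵥ v ∈ W) →
    (∀ v ∈ W, (B : Matrix (Fin r) (Fin r) ℂ) *ᵥ v ∈ W) → W = ⊥ ∨ W = ⊤

/-- The conjugacy classes of irreducible representations. -/
def irreducibleLocus (n r : ℕ) : Set (CharVar n r) :=
  {x | ∃ ρ : RepVar n r, ⟦ρ⟧ = x ∧ IsIrreduciblePair ρ.1.1 ρ.1.2}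

/-! ### Symmetric products -/

/-- The unordered configuration underlying a tuple. -/
def config {X : Type*} {r : ℕ} (l : Fin r → X) : Sym X r :=
  ⟨Finset.univ.val.map l, by simp⟩

/-- `Sym X r` is `X ^ r` modulo permutations, with the quotient topology. -/
instance symTopology (X : Type*) [TopologicalSpace X] (r : ℕ) : TopologicalSpace (Sym X r) :=
  TopologicalSpace.coinduced config inferInstance

/-- Zariski closed subsets of the torus `(S¹) ^ r ⊆ ℂ ^ r = ℝ ^ (2r)`: common zero sets of real
polynomials in the real and imaginary parts of the coordinates. -/
def IsZariskiClosedTorus {r : ℕ} (Z : Set (Fin r → Circle)) : Prop :=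
  ∃ S : Set (MvPolynomial (Fin r ⊕ Fin r) ℝ),
    Z = {l | ∀ p ∈ S, MvPolynomial.eval
      (Sum.elim (fun i => (l i : ℂ).re) (fun i => (l i : ℂ).im)) p = 0}

/-- Zariski open subsets of `Sym ^ r (S¹) = (S¹) ^ r / S_r`: those whose preimage in the torus is
Zariski open. -/
def IsZariskiOpenSym {r : ℕ} (V : Set (Sym Circle r)) : Prop :=
  IsZariskiClosedTorus (config ⁻¹' V)ᶜ

/-- The type of a configuration: the partition of `r` formed by the multiplicities of its distinct
points. -/
def multType {r : ℕ} (s : Sym Circle r) : r.Partition := by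
  classical exact Nat.Partition.ofSym s

/-! ### The eigenvalue map -/

open scoped ComplexOrder in
theorem norm_eq_one_of_mem_roots {r : ℕ} (A : U r) {z : ℂ}
    (hz : z ∈ (A : Matrix (Fin r) (Fin r) ℂ).charpoly.roots) : ‖z‖ = 1 := by
  have hroot := (Polynomial.mem_roots'.1 hz).2
  have hdet : (Matrix.scalar (Fin r) z - (A : Matrix (Fin r) (Fin r) ℂ)).det = 0 := by
    rw [← Matrix.eval_charpoly]; exact hroot
  obtain ⟨v, hv, hAv⟩ := Matrix.exists_mulVec_eq_zero_iff.2 hdet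
  have hAv' : (A : Matrix (Fin r) (Fin r) ℂ) *ᵥ v = z • v := by
    rw [Matrix.sub_mulVec, sub_eq_zero] at hAv
    rw [← hAv]
    ext i
    simp [Matrix.scalar_apply, Matrix.mulVec_diagonal]
  have hA : (A : Matrix (Fin r) (Fin r) ℂ)ᴴ * (A : Matrix (Fin r) (Fin r) ℂ) = 1 :=
    Matrix.mem_unitaryGroup_iff'.1 A.2
  have h1 : star (z • v) ⬝ᵥ (z • v) = star v ⬝ᵥ v := by
    rw [← hAv', Matrix.star_mulVec, Matrix.dotProduct_mulVec, Matrix.vecMul_vecMul, hA,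
      Matrix.vecMul_one]
  have hne : star v ⬝ᵥ v ≠ 0 := fun h => hv (dotProduct_star_self_eq_zero.1 h)
  rw [star_smul, smul_dotProduct, dotProduct_smul, smul_eq_mul, smul_eq_mul, ← mul_assoc] at h1
  have h2 : star z * z = 1 := mul_right_cancel₀ hne (by rw [h1, one_mul])
  have h3 : ‖z‖ * ‖z‖ = 1 := by
    have := congrArg norm h2
    simpa using this
  nlinarith [norm_nonneg z]

/-- A complex number of modulus one, as a point of the circle. -/
def toCircle (z : ℂ) (hz : ‖z‖ = 1) : Circle := ⟨z, mem_sphere_zero_iff_norm.2 hz⟩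

/-- The eigenvalues of a unitary matrix, counted with multiplicity. -/
def spec {r : ℕ} (A : U r) : Sym Circle r :=
  ⟨(A : Matrix (Fin r) (Fin r) ℂ).charpoly.roots.pmap toCircle
      (fun _ hz => norm_eq_one_of_mem_roots A hz), by
    rw [Multiset.card_pmap, ← (IsAlgClosed.splits _).natDegree_eq_card_roots,
      Matrix.charpoly_natDegree_eq_dim, Fintype.card_fin]⟩

theorem spec_conj {r : ℕ} (g : ConjAct (U r)) (A : U r) : spec (g • A) = spec A := by
  have h : ((g • A : U r) : Matrix (Fin r) (Fin r) ℂ).charpoly =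
      (A : Matrix (Fin r) (Fin r) ℂ).charpoly := by
    rw [ConjAct.smul_def, Submonoid.coe_mul, Matrix.charpoly_mul_comm, ← Submonoid.coe_mul,
      ← mul_assoc, inv_mul_cancel, one_mul]
  apply Subtype.ext
  simp only [spec, h]

/-- The map sending the class of `(A, B)` to the eigenvalues of `A`. -/
def eigenvalueMap (n r : ℕ) : CharVar n r → Sym Circle r :=
  Quotient.lift (fun ρ : RepVar n r => spec ρ.1.1) (by
    rintro ρ ρ' ⟨g, rfl⟩
    exact spec_conj g ρ'.1.1)

/-- The stratum `X_σ^*`: irreducible classes `(A, B)` such that the eigenvalues of `A` have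
multiplicities given by `σ`. -/
def Stratum (n : ℕ) {r : ℕ} (σ : r.Partition) : Set (CharVar n r) :=
  {x | x ∈ irreducibleLocus n r ∧ multType (eigenvalueMap n r x) = σ}

/-- The configurations of type `σ` all of whose points have the same `n`-th power. -/
def Base (n : ℕ) {r : ℕ} (σ : r.Partition) : Set (Sym Circle r) :=
  {s | multType s = σ ∧ ∀ z ∈ s, ∀ w ∈ s, z ^ n = w ^ n}

/-! ### The fiber -/

/-- The diagonal matrix `diag(λ₁, …, λ_r)`. -/
def diagU {r : ℕ} (l : Fin r → Circle) : U r :=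
  ⟨Matrix.diagonal fun i => (l i : ℂ), by
    rw [Matrix.mem_unitaryGroup_iff, Matrix.star_eq_conjTranspose, Matrix.diagonal_conjTranspose,
      Matrix.diagonal_mul_diagonal, ← Matrix.diagonal_one]
    congr 1
    ext i
    simp [Complex.mul_conj, Circle.normSq_coe]⟩

/-- The stabilizer of `diag(λ₁, …, λ_r)` in `U(r)`, for the conjugation action. -/
abbrev Stab {r : ℕ} (l : Fin r → Circle) : Subgroup (ConjAct (U r)) :=
  MulAction.stabilizer (ConjAct (U r)) (diagU l)

/-- `U(r)` modulo conjugation by the stabilizer of `diag(λ₁, …, λ_r)`, with the quotient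
topology. -/
abbrev ConjQuotient {r : ℕ} (l : Fin r → Circle) : Type :=
  Quotient (MulAction.orbitRel (Stab l) (U r))

/-- The classes of those `B` that have no nontrivial invariant subspace in common with
`diag(λ₁, …, λ_r)`. -/
def Fiber {r : ℕ} (l : Fin r → Circle) : Set (ConjQuotient l) :=
  {x | ∃ B : U r, ⟦B⟧ = x ∧ IsIrreduciblePair (diagU l) B}

end TwistedHopf

end

/-! The proof removes `B` from the relation and then orders the eigenvalues of `A` continuously. If
`(A, B)` is irreducible, an eigenspace of `A ^ n` is invariant under both, hence everything: `A ^ n`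
is scalar and the values lie in `Base` (`pow_eq_pow_of_isIrreduciblePair`). Conversely, a scalar `A
^ n` leaves `B` unconstrained (`commutator_diagU_pow`).

Suppose the configurations in an open set are ordered continuously, with the coincidences of `l`. A
class over `s` is then represented by `(diagU (L s), B)`, with `B` unique up to the stabilizer of
`diagU (L s)`. This stabilizer, and irreducibility with `B`, depend only on the coincidences
(`stab_eq_stab`, `IsIrreduciblePair.of_diagU`), so the class of `B` lies in the fixed space `Fiber
l`. Diagonalizing matrices cannot in general be chosen continuously, but compactness of `U(r)` makes
the resulting bijection a homeomorphism (`OrderedSection.homeomorph`).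

Such orderings exist where the common `n`-th power avoids `-w ^ n`, a Zariski open condition. There
the common power has a continuous `n`-th root; dividing by it leaves `n`-th roots of unity, a finite
discrete set on which any choice of ordering is continuous (`orderedSection`). -/

noncomputable section

namespace TwistedHopf

/-! ### Spectral theorem for isometries -/

section Isometry

open Module.End

variable {E : Type*} [NormedAddCommGroup E] [InnerProductSpace ℂ E] {T : E →ₗ[ℂ] E}

theorem norm_eigenvalue_eq_one_of_isometry (hT : ∀ v w, inner ℂ (T v) (T w) = inner ℂ v w) {μ : ℂ}
    {v : E} (hv : T v = μ • v) (h0 : v ≠ 0) : (starRingEnd ℂ) μ * μ = 1 := by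
  have h := hT v v
  rw [hv, inner_smul_left, inner_smul_right, ← mul_assoc] at h
  exact mul_right_cancel₀ (inner_self_ne_zero.2 h0) (h.trans (one_mul _).symm)

/-- Non-orthogonal eigenvectors give `conj μ * ν = 1`, while `conj μ * μ = 1`; hence `μ = ν`. -/
theorem orthogonalFamily_eigenspaces_of_isometry
    (hT : ∀ v w, inner ℂ (T v) (T w) = inner ℂ v w) :
    OrthogonalFamily ℂ (fun μ => eigenspace T μ) fun μ => (eigenspace T μ).subtypeₗᵢ := by
  refine OrthogonalFamily.of_pairwise fun μ ν hμν v hv w hw => ?_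
  rw [mem_eigenspace_iff] at hv hw
  by_cases h0 : v = 0
  · simp [h0]
  have hμ := norm_eigenvalue_eq_one_of_isometry hT hv h0
  have h := hT v w
  rw [hv, hw, inner_smul_left, inner_smul_right, ← mul_assoc] at h
  by_contra hne
  have hne' : inner ℂ v w ≠ 0 := fun h => hne (by rw [← inner_conj_symm, h, map_zero])
  have h1 : (starRingEnd ℂ) μ * ν = 1 := mul_right_cancel₀ hne' (h.trans (one_mul _).symm)
  exact hμν (mul_left_cancel₀ (left_ne_zero_of_mul_eq_one hμ) (hμ.trans h1.symm))

/-- For an eigenvector `u` and `v ⊥ u`, `0 = ⟪T u, T v⟫ = conj μ * ⟪u, T v⟫` with `μ ≠ 0`, so the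
complement is `T`-invariant. Were it nonzero, it would contain an eigenvector, orthogonal to itself.
-/
theorem orthogonal_iSup_eigenspaces_of_isometry [FiniteDimensional ℂ E]
    (hT : ∀ v w, inner ℂ (T v) (T w) = inner ℂ v w) :
    (⨆ μ : Eigenvalues T, eigenspace T μ)ᗮ = ⊥ := by
  have hle : ∀ μ : ℂ, eigenspace T μ ≤ ⨆ μ : Eigenvalues T, eigenspace T μ := by
    intro μ
    by_cases h : eigenspace T μ = ⊥
    · rw [h]; exact bot_le
    · exact le_iSup (fun μ : Eigenvalues T => eigenspace T μ) ⟨μ, h⟩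
  set S := ⨆ μ : Eigenvalues T, eigenspace T μ with hS
  have hinv : ∀ v ∈ Sᗮ, T v ∈ Sᗮ := by
    intro v hv
    rw [hS, ← Submodule.iInf_orthogonal, Submodule.mem_iInf]
    rintro ⟨μ, hμ⟩
    rw [Submodule.mem_orthogonal]
    intro u hu
    have hu' := mem_eigenspace_iff.1 hu
    by_cases h0 : u = 0
    · simp [h0]
    have h1 := norm_eigenvalue_eq_one_of_isometry hT hu' h0
    have h2 := hT u v
    rw [(Submodule.mem_orthogonal _ _).1 hv u (hle μ hu), hu', inner_smul_left] at h2
    exact (mul_eq_zero.1 h2).resolve_left (left_ne_zero_of_mul_eq_one h1)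
  by_contra hne
  have : Nontrivial Sᗮ := Submodule.nontrivial_iff_ne_bot.2 hne
  obtain ⟨c, hc⟩ := exists_eigenvalue (T.restrict hinv)
  obtain ⟨v, hv⟩ := hc.exists_hasEigenvector
  have hv1 : T v = c • (v : E) := congrArg Subtype.val hv.apply_eq_smul
  have hv2 : (v : E) ∈ S := hle c (mem_eigenspace_iff.2 hv1)
  have h3 := (Submodule.mem_orthogonal _ _).1 v.2 v hv2
  exact hv.2 (Subtype.ext (inner_self_eq_zero.1 h3))

theorem exists_orthonormalBasis_eigenvectors_of_isometry [FiniteDimensional ℂ E] {r : ℕ}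
    (hr : Module.finrank ℂ E = r) (hT : ∀ v w, inner ℂ (T v) (T w) = inner ℂ v w) :
    ∃ b : OrthonormalBasis (Fin r) ℂ E, ∀ i, ∃ μ : ℂ, T (b i) = μ • b i := by
  classical
  have ho : OrthogonalFamily ℂ (fun μ : Eigenvalues T => eigenspace T μ)
      fun μ => (eigenspace T μ).subtypeₗᵢ :=
    (orthogonalFamily_eigenspaces_of_isometry hT).comp (fun a b h => Subtype.ext h)
  have hi : DirectSum.IsInternal (fun μ : Eigenvalues T => eigenspace T μ) :=
    ho.isInternal_iff.2 (orthogonal_iSup_eigenspaces_of_isometry hT)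
  exact ⟨hi.subordinateOrthonormalBasis hr ho, fun i =>
    ⟨_, mem_eigenspace_iff.1 (hi.subordinateOrthonormalBasis_subordinate hr i ho)⟩⟩

end Isometry

/-! ### Unitary diagonalization and spectra -/

theorem exists_eq_conj_diagU {r : ℕ} (A : U r) : ∃ (g : U r) (l : Fin r → Circle),
    A = g * diagU l * g⁻¹ := by
  have hA : (A : Matrix (Fin r) (Fin r) ℂ)ᴴ * (A : Matrix (Fin r) (Fin r) ℂ) = 1 :=
    Matrix.mem_unitaryGroup_iff'.1 A.2
  have hT : ∀ v w, inner ℂ (Matrix.toEuclideanLin (A : Matrix (Fin r) (Fin r) ℂ) v)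
      (Matrix.toEuclideanLin (A : Matrix (Fin r) (Fin r) ℂ) w) = inner ℂ v w := by
    intro v w
    rw [← LinearMap.adjoint_inner_right, ← Matrix.toEuclideanLin_conjTranspose_eq_adjoint]
    congr 1
    apply WithLp.ofLp_injective
    simp [Matrix.toLpLin_apply, Matrix.mulVec_mulVec, hA]
  obtain ⟨b, hb⟩ := exists_orthonormalBasis_eigenvectors_of_isometry
    (r := r) finrank_euclideanSpace_fin hT
  choose μ hμ using hb
  have hμ1 : ∀ i, ‖μ i‖ = 1 := by
    intro i
    have := norm_eigenvalue_eq_one_of_isometry hT (hμ i) (b.orthonormal.ne_zero i)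
    have := congrArg norm this
    simp only [norm_mul, RCLike.norm_conj, norm_one] at this
    nlinarith [norm_nonneg (μ i)]
  let g : U r := ⟨(EuclideanSpace.basisFun (Fin r) ℂ).toBasis.toMatrix b,
    (EuclideanSpace.basisFun (Fin r) ℂ).toMatrix_orthonormalBasis_mem_unitary b⟩
  refine ⟨g, fun i => toCircle (μ i) (hμ1 i), ?_⟩
  rw [eq_mul_inv_iff_mul_eq]
  apply Subtype.ext
  ext i j
  have h := congrArg (fun v : EuclideanSpace ℂ (Fin r) => v i) (hμ j)
  simp only [Matrix.toLpLin_apply, PiLp.smul_apply, smul_eq_mul] at h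
  change (_ * _ : Matrix (Fin r) (Fin r) ℂ) i j = (_ * Matrix.diagonal _ : Matrix _ _ ℂ) i j
  rw [Matrix.mul_diagonal]
  simpa [Matrix.mul_apply, Matrix.mulVec, dotProduct, g, Module.Basis.toMatrix_apply, toCircle,
    mul_comm] using h

theorem spec_diagU {r : ℕ} (l : Fin r → Circle) : spec (diagU l) = config l := by
  apply Subtype.ext
  have h : ((diagU l : U r) : Matrix (Fin r) (Fin r) ℂ).charpoly.roots =
      (Finset.univ.val.map l).map (fun z : Circle => (z : ℂ)) := by
    change (Matrix.diagonal fun i => (l i : ℂ)).charpoly.roots = _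
    rw [Matrix.charpoly_diagonal, Multiset.map_map,
      ← Polynomial.roots_multiset_prod_X_sub_C (Multiset.map _ _), Multiset.map_map]
    rfl
  apply Multiset.map_injective (f := fun z : Circle => (z : ℂ)) Subtype.val_injective
  refine Eq.trans ?_ h
  change Multiset.map _ (Multiset.pmap _ _ _) = _
  rw [Multiset.map_pmap]
  exact (Multiset.pmap_eq_map _ _ _ _).trans (Multiset.map_id _)

theorem spec_conj_diagU {r : ℕ} (g : U r) (l : Fin r → Circle) :
    spec (g * diagU l * g⁻¹) = config l := by
  rw [← spec_diagU, ← spec_conj (ConjAct.toConjAct g) (diagU l), ConjAct.smul_def]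
  rfl

/-- Equal multiplicities give bijections between the fibers of the two tuples over each point; these
glue to a permutation. -/
theorem exists_perm_of_config_eq {X : Type*} {r : ℕ} {l l' : Fin r → X}
    (h : config l = config l') : ∃ π : Equiv.Perm (Fin r), l' = l ∘ π := by
  have h' : Finset.univ.val.map l = Finset.univ.val.map l' := congrArg Subtype.val h
  classical
  have hc : ∀ x, Nonempty ({i // l' i = x} ≃ {i // l i = x}) := by
    intro x
    have := congrArg (Multiset.count x) h'
    rw [Multiset.count_map, Multiset.count_map] at this
    refine Fintype.card_eq.1 ?_
    rw [Fintype.card_subtype, Fintype.card_subtype]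
    simp only [eq_comm (a := x)] at this
    exact this.symm
  exact ⟨Equiv.ofFiberEquiv fun x => (hc x).some,
    funext fun i => (Equiv.ofFiberEquiv_map _ i).symm⟩

theorem exists_eq_conj_diagU_of_config_eq {r : ℕ} {l l' : Fin r → Circle}
    (h : config l = config l') : ∃ g : U r, diagU l = g * diagU l' * g⁻¹ := by
  obtain ⟨π, rfl⟩ := exists_perm_of_config_eq h
  -- The permutation matrix whose column `j` is the basis vector `π j`.
  refine ⟨⟨(1 : Matrix (Fin r) (Fin r) ℂ).submatrix id π, ?_⟩, ?_⟩
  · rw [Matrix.mem_unitaryGroup_iff', Matrix.star_eq_conjTranspose, Matrix.conjTranspose_submatrix,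
      ← Equiv.coe_refl, Matrix.submatrix_mul_equiv]
    simp
  · rw [eq_mul_inv_iff_mul_eq]
    apply Subtype.ext
    change (Matrix.diagonal _ * _ : Matrix (Fin r) (Fin r) ℂ) = _ * Matrix.diagonal _
    ext i j
    rw [Matrix.mul_diagonal, Matrix.diagonal_mul]
    by_cases hij : i = π j
    · subst hij
      exact mul_comm _ _
    · simp [hij]

theorem exists_eq_conj_diagU_of_spec_eq {r : ℕ} {A : U r} {l : Fin r → Circle}
    (h : spec A = config l) : ∃ g : U r, A = g * diagU l * g⁻¹ := by
  obtain ⟨g, m, rfl⟩ := exists_eq_conj_diagU A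
  rw [spec_conj_diagU] at h
  obtain ⟨k, hk⟩ := exists_eq_conj_diagU_of_config_eq h
  exact ⟨g * k, by rw [hk]; group⟩

theorem diagU_pow {r : ℕ} (l : Fin r → Circle) (n : ℕ) : diagU l ^ n = diagU (l ^ n) := by
  apply Subtype.ext
  change (Matrix.diagonal _ : Matrix (Fin r) (Fin r) ℂ) ^ n = Matrix.diagonal _
  rw [Matrix.diagonal_pow]
  congr 1

theorem conj_diagU_pow_mulVec {r : ℕ} (g : U r) (l : Fin r → Circle) (n : ℕ) (i : Fin r) :
    (((g * diagU l * g⁻¹) ^ n : U r) : Matrix (Fin r) (Fin r) ℂ) *ᵥ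
      ((g : Matrix (Fin r) (Fin r) ℂ) *ᵥ Pi.single i 1) =
      ((l i : ℂ) ^ n) • ((g : Matrix (Fin r) (Fin r) ℂ) *ᵥ Pi.single i 1) := by
  have h : (g * diagU l * g⁻¹) ^ n * g = g * diagU (l ^ n) := by
    rw [conj_pow, diagU_pow]; group
  have h2 : (Matrix.diagonal fun i => ((l ^ n) i : ℂ)) *ᵥ Pi.single i 1 =
      ((l i : ℂ) ^ n) • (Pi.single i 1 : Fin r → ℂ) := by
    rw [Matrix.diagonal_mulVec_single, ← Pi.single_smul]
    simp
  rw [Matrix.mulVec_mulVec, ← Submonoid.coe_mul, h, Submonoid.coe_mul, ← Matrix.mulVec_mulVec,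
    ← Matrix.mulVec_smul, ← h2]
  rfl

theorem inv_mulVec_mulVec {r : ℕ} (g : U r) (v : Fin r → ℂ) :
    ((g⁻¹ : U r) : Matrix (Fin r) (Fin r) ℂ) *ᵥ ((g : Matrix (Fin r) (Fin r) ℂ) *ᵥ v) = v := by
  rw [Matrix.mulVec_mulVec, ← Submonoid.coe_mul, inv_mul_cancel, Submonoid.coe_one,
    Matrix.one_mulVec]

theorem mulVec_inv_mulVec {r : ℕ} (g : U r) (v : Fin r → ℂ) :
    (g : Matrix (Fin r) (Fin r) ℂ) *ᵥ (((g⁻¹ : U r) : Matrix (Fin r) (Fin r) ℂ) *ᵥ v) = v := by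
  simpa only [inv_inv] using inv_mulVec_mulVec g⁻¹ v

/-! ### Irreducible pairs and stabilizers -/

theorem IsIrreduciblePair.conj {r : ℕ} {A B : U r} (h : IsIrreduciblePair A B) (g : U r) :
    IsIrreduciblePair (g * A * g⁻¹) (g * B * g⁻¹) := by
  intro W hA hB
  have key : ∀ C : U r, (∀ v ∈ W, ((g * C * g⁻¹ : U r) : Matrix (Fin r) (Fin r) ℂ) *ᵥ v ∈ W) →
      ∀ v ∈ W.comap (Matrix.mulVecLin (g : Matrix (Fin r) (Fin r) ℂ)),
        (C : Matrix (Fin r) (Fin r) ℂ) *ᵥ v ∈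
          W.comap (Matrix.mulVecLin (g : Matrix (Fin r) (Fin r) ℂ)) := by
    intro C hC v hv
    have := hC _ hv
    rwa [Submonoid.coe_mul, Submonoid.coe_mul, Matrix.mulVecLin_apply, ← Matrix.mulVec_mulVec,
      inv_mulVec_mulVec, ← Matrix.mulVec_mulVec] at this
  have hmem : ∀ v ∈ W, ((g⁻¹ : U r) : Matrix (Fin r) (Fin r) ℂ) *ᵥ v ∈
      W.comap (Matrix.mulVecLin (g : Matrix (Fin r) (Fin r) ℂ)) := by
    intro v hv
    rwa [Submodule.mem_comap, Matrix.mulVecLin_apply, mulVec_inv_mulVec]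
  rcases h _ (key A hA) (key B hB) with h0 | h0
  · left
    rw [Submodule.eq_bot_iff]
    intro v hv
    have := hmem v hv
    rw [h0, Submodule.mem_bot] at this
    rw [← mulVec_inv_mulVec g v, this, Matrix.mulVec_zero]
  · right
    rw [Submodule.eq_top_iff']
    intro v
    have : ((g⁻¹ : U r) : Matrix (Fin r) (Fin r) ℂ) *ᵥ v ∈
      W.comap (Matrix.mulVecLin (g : Matrix (Fin r) (Fin r) ℂ)) := h0 ▸ Submodule.mem_top
    rwa [Submodule.mem_comap, Matrix.mulVecLin_apply, mulVec_inv_mulVec] at this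

theorem mem_config {X : Type*} {r : ℕ} {l : Fin r → X} {x : X} :
    x ∈ config l ↔ ∃ i, l i = x := by
  change x ∈ Multiset.map l Finset.univ.val ↔ _
  simp

/-- Schur's lemma: `A ^ n` commutes with `A` and `B`, so its eigenspace `W` through the `i`-th
eigenvector is invariant and nonzero, hence contains the `j`-th eigenvector too. -/
theorem pow_eq_pow_of_isIrreduciblePair {n r : ℕ} {A B : U r} (hirr : IsIrreduciblePair A B)
    (h : A ^ n * B * (A ^ n)⁻¹ * B⁻¹ = 1) : ∀ z ∈ spec A, ∀ w ∈ spec A, z ^ n = w ^ n := by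
  obtain ⟨g, l, rfl⟩ := exists_eq_conj_diagU A
  rw [spec_conj_diagU]
  have hB : (g * diagU l * g⁻¹) ^ n * B = B * (g * diagU l * g⁻¹) ^ n := by
    rwa [mul_inv_eq_one, mul_inv_eq_iff_eq_mul] at h
  have hA := (Commute.refl (g * diagU l * g⁻¹)).pow_left n
  have hv := conj_diagU_pow_mulVec g l n
  set A := g * diagU l * g⁻¹
  intro z hz w hw
  obtain ⟨i, rfl⟩ := mem_config.1 hz
  obtain ⟨j, rfl⟩ := mem_config.1 hw
  let W : Submodule ℂ (Fin r → ℂ) := Module.End.eigenspace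
    (Matrix.mulVecLin ((A ^ n : U r) : Matrix (Fin r) (Fin r) ℂ)) ((l i : ℂ) ^ n)
  have hne : ∀ k, (g : Matrix (Fin r) (Fin r) ℂ) *ᵥ Pi.single k 1 ≠ 0 := by
    intro k h0
    have h1 := inv_mulVec_mulVec g (Pi.single k 1)
    rw [h0, Matrix.mulVec_zero] at h1
    simpa using congrFun h1 k
  have hinv : ∀ C : U r, A ^ n * C = C * A ^ n → ∀ v ∈ W,
      (C : Matrix (Fin r) (Fin r) ℂ) *ᵥ v ∈ W := by
    intro C hC v hv
    rw [Module.End.mem_eigenspace_iff, Matrix.mulVecLin_apply] at hv ⊢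
    rw [Matrix.mulVec_mulVec, ← Submonoid.coe_mul, hC, Submonoid.coe_mul, ← Matrix.mulVec_mulVec,
      hv, Matrix.mulVec_smul]
  have hi : (g : Matrix (Fin r) (Fin r) ℂ) *ᵥ Pi.single i 1 ∈ W :=
    Module.End.mem_eigenspace_iff.2 (hv i)
  rcases hirr W (hinv A hA) (hinv B hB) with h0 | h0
  · rw [h0] at hi
    exact absurd hi (hne i)
  · have hj : (g : Matrix (Fin r) (Fin r) ℂ) *ᵥ Pi.single j 1 ∈ W := h0 ▸ Submodule.mem_top
    have hj1 := Module.End.mem_eigenspace_iff.1 hj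
    rw [Matrix.mulVecLin_apply, hv j] at hj1
    have := smul_left_injective ℂ (hne j) hj1
    apply Circle.ext
    simpa using this.symm

theorem commutator_diagU_pow {n r : ℕ} {l : Fin r → Circle} (h : ∀ i j, l i ^ n = l j ^ n)
    (B : U r) : diagU l ^ n * B * (diagU l ^ n)⁻¹ * B⁻¹ = 1 := by
  rw [mul_inv_eq_one, mul_inv_eq_iff_eq_mul, diagU_pow]
  apply Subtype.ext
  change (Matrix.diagonal _ * _ : Matrix (Fin r) (Fin r) ℂ) = _ * Matrix.diagonal _
  ext i j
  rw [Matrix.mul_diagonal, Matrix.diagonal_mul, mul_comm, Pi.pow_apply, Pi.pow_apply, h i j]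

/-- Commuting with a diagonal matrix means `g i j * (l j - l i) = 0` entrywise. Hence the stabilizer
sees only which entries of `l` coincide. -/
theorem mem_stab_iff {r : ℕ} {l : Fin r → Circle} {g : ConjAct (U r)} :
    g ∈ Stab l ↔ ∀ i j, ((ConjAct.ofConjAct g : U r) : Matrix (Fin r) (Fin r) ℂ) i j = 0 ∨ l i = l j := by
  rw [MulAction.mem_stabilizer_iff, ConjAct.smul_def, mul_inv_eq_iff_eq_mul, ← Subtype.val_inj]
  change (_ * Matrix.diagonal _ : Matrix (Fin r) (Fin r) ℂ) = Matrix.diagonal _ * _ ↔ _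
  rw [← Matrix.ext_iff]
  refine forall_congr' fun i => forall_congr' fun j => ?_
  rw [Matrix.mul_diagonal, Matrix.diagonal_mul, mul_comm, mul_eq_mul_right_iff, or_comm,
    Circle.coe_inj, eq_comm (a := l j)]

theorem stab_eq_stab {r : ℕ} {l m : Fin r → Circle} (h : ∀ i j, l i = l j ↔ m i = m j) :
    Stab l = Stab m := by
  ext g
  simp only [mem_stab_iff, h]

open Polynomial in
theorem exists_aeval_diagonal_eq {ι K : Type*} [Fintype ι] [DecidableEq ι] [Field K] {l m : ι → K}
    (h : ∀ i j, l i = l j → m i = m j) :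
    ∃ p : K[X], aeval (Matrix.diagonal l) p = Matrix.diagonal m := by
  classical
  -- By `h`, the extension takes `l i` to `m i`; its default `0` is never used, as all nodes lie in
  -- the range of `l`.
  refine ⟨Lagrange.interpolate (Finset.univ.image l) id (Function.extend l m 0), ?_⟩
  have h1 := Polynomial.aeval_algHom_apply (Matrix.diagonalAlgHom (n := ι) (α := K) K) l
    (Lagrange.interpolate (Finset.univ.image l) id (Function.extend l m 0))
  refine h1.trans ?_
  change Matrix.diagonal _ = _
  congr 1
  ext i
  have h2 := Polynomial.aeval_algHom_apply (Pi.evalAlgHom K (fun _ : ι => K) i) l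
    (Lagrange.interpolate (Finset.univ.image l) id (Function.extend l m 0))
  refine h2.symm.trans ?_
  have h3 := Lagrange.eval_interpolate_at_node (s := Finset.univ.image l) (v := id)
    (Function.extend l m 0) Function.injective_id.injOn
    (Finset.mem_image_of_mem l (Finset.mem_univ i))
  rw [Function.FactorsThrough.extend_apply (fun a b hab => h a b hab)] at h3
  exact h3

open Polynomial in
theorem aeval_mulVec_mem {ι K : Type*} [Fintype ι] [DecidableEq ι] [Field K] {M : Matrix ι ι K}
    {W : Submodule K (ι → K)} (hW : ∀ v ∈ W, M *ᵥ v ∈ W) (p : K[X]) :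
    ∀ v ∈ W, aeval M p *ᵥ v ∈ W := by
  induction p using Polynomial.induction_on' with
  | add p q hp hq =>
    intro v hv
    rw [map_add, Matrix.add_mulVec]
    exact W.add_mem (hp v hv) (hq v hv)
  | monomial n a =>
    intro v hv
    have hpow : M ^ n *ᵥ v ∈ W := by
      induction n with
      | zero => simpa using hv
      | succ n ih =>
        rw [pow_succ', ← Matrix.mulVec_mulVec]
        exact hW _ ih
    rw [aeval_monomial, ← Algebra.smul_def, Matrix.smul_mulVec]
    exact W.smul_mem a hpow

/-- `diagU l` is a polynomial in `diagU m`, so every subspace invariant under `diagU m` is invariant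
under `diagU l`. -/
theorem IsIrreduciblePair.of_diagU {r : ℕ} {l m : Fin r → Circle} {B : U r}
    (h : ∀ i j, m i = m j → l i = l j) (hB : IsIrreduciblePair (diagU l) B) :
    IsIrreduciblePair (diagU m) B := by
  intro W hm hW
  obtain ⟨p, hp⟩ := exists_aeval_diagonal_eq (l := fun i => (m i : ℂ)) (m := fun i => (l i : ℂ))
    (fun i j hij => congrArg _ (h i j (Circle.ext hij)))
  refine hB W (fun v hv => ?_) hW
  change Matrix.diagonal _ *ᵥ v ∈ W
  rw [← hp]
  exact aeval_mulVec_mem hm p v hv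

/-! ### Compactness, quotient maps and continuity of the spectrum -/

instance compactSpace_unitaryGroup (r : ℕ) : CompactSpace (U r) := by
  refine isCompact_iff_compactSpace.1 ?_
  have hK : IsCompact (Set.univ.pi fun _ : Fin r => Set.univ.pi fun _ : Fin r =>
      Metric.closedBall (0 : ℂ) 1) :=
    isCompact_univ_pi fun _ => isCompact_univ_pi fun _ => isCompact_closedBall _ _
  refine hK.of_isClosed_subset ?_ ?_
  · have : (Matrix.unitaryGroup (Fin r) ℂ : Set (Matrix (Fin r) (Fin r) ℂ)) =
        {M | Mᴴ * M = 1} := by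
      ext M
      exact Matrix.mem_unitaryGroup_iff'
    rw [this]
    exact isClosed_eq (by fun_prop) continuous_const
  · intro M hM
    rw [Set.mem_univ_pi]
    intro i
    rw [Set.mem_univ_pi]
    intro j
    rw [mem_closedBall_zero_iff]
    exact entry_norm_bound_of_unitary hM i j

theorem continuous_diagU {r : ℕ} : Continuous (diagU : (Fin r → Circle) → U r) := by
  refine Continuous.subtype_mk (Continuous.matrix_diagonal ?_) _
  fun_prop

/-- The saturation of an open set is the union of its translates under permutations. Openness
matters because open quotient maps, unlike general ones, restrict to preimages of arbitrary subsets.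
-/
theorem isOpenQuotientMap_config {X : Type*} [TopologicalSpace X] {r : ℕ} :
    IsOpenQuotientMap (config : (Fin r → X) → Sym X r) := by
  have hq : Topology.IsQuotientMap (config : (Fin r → X) → Sym X r) := by
    refine ⟨⟨rfl⟩, ?_⟩
    rintro ⟨s, hs⟩
    obtain ⟨L, rfl⟩ := Quot.exists_rep s
    change L.length = r at hs
    subst hs
    refine ⟨L.get, Subtype.ext ?_⟩
    change Multiset.map L.get Finset.univ.val = _
    rw [Fin.univ_val_map]
    exact congrArg _ (List.ofFn_get L)
  refine IsOpenQuotientMap.of_isOpenMap_isQuotientMap (fun O hO => ?_) hq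
  rw [← hq.isOpen_preimage]
  have : config ⁻¹' (config '' O) =
      ⋃ π : Equiv.Perm (Fin r), (fun l : Fin r → X => l ∘ π) ⁻¹' O := by
    ext l
    simp only [Set.mem_preimage, Set.mem_image, Set.mem_iUnion]
    constructor
    · rintro ⟨m, hm, hml⟩
      obtain ⟨π, rfl⟩ := exists_perm_of_config_eq hml.symm
      exact ⟨π, hm⟩
    · rintro ⟨π, hπ⟩
      refine ⟨_, hπ, Subtype.ext ?_⟩
      change Multiset.map (l ∘ π) Finset.univ.val = Multiset.map l Finset.univ.val
      rw [← Multiset.map_map, Multiset.map_univ_val_equiv]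
  rw [this]
  exact isOpen_iUnion fun π => hO.preimage (by fun_prop)

/-- By compactness, `(g, l) ↦ g * diagU l * g⁻¹` is a closed surjection, hence a quotient map; the
spectrum pulls back along it to the continuous map `config l`. -/
theorem continuous_spec {r : ℕ} : Continuous (spec : U r → Sym Circle r) := by
  have hc : Continuous fun p : U r × (Fin r → Circle) => p.1 * diagU p.2 * p.1⁻¹ :=
    (continuous_fst.mul (continuous_diagU.comp continuous_snd)).mul continuous_fst.inv
  have hq := hc.isClosedMap.isQuotientMap hc
    (fun A => by obtain ⟨g, l, h⟩ := exists_eq_conj_diagU A; exact ⟨(g, l), h.symm⟩)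
  rw [hq.continuous_iff]
  refine (isOpenQuotientMap_config.continuous.comp continuous_snd).congr fun p => ?_
  exact (spec_conj_diagU p.1 p.2).symm

instance continuousConstSMul_repVar (n r : ℕ) :
    ContinuousConstSMul (ConjAct (U r)) (RepVar n r) where
  continuous_const_smul g :=
    (continuous_subtype_val.const_smul g).subtype_mk fun ρ => (g • ρ).2

theorem continuous_eigenvalueMap {n r : ℕ} : Continuous (eigenvalueMap n r) :=
  (continuous_spec.comp (continuous_fst.comp continuous_subtype_val)).quotient_lift _

theorem mk_mem_irreducibleLocus {n r : ℕ} {ρ : RepVar n r} :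
    (⟦ρ⟧ : CharVar n r) ∈ irreducibleLocus n r ↔ IsIrreduciblePair ρ.1.1 ρ.1.2 := by
  refine ⟨?_, fun h => ⟨ρ, rfl, h⟩⟩
  rintro ⟨ρ', h, hirr⟩
  obtain ⟨g, hg⟩ := Quotient.exact h.symm
  rw [← hg]
  exact hirr.conj (ConjAct.ofConjAct g)

theorem mk_mem_fiber {r : ℕ} {l : Fin r → Circle} {B : U r} :
    (⟦B⟧ : ConjQuotient l) ∈ Fiber l ↔ IsIrreduciblePair (diagU l) B := by
  refine ⟨?_, fun h => ⟨B, rfl, h⟩⟩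
  rintro ⟨B', h, hirr⟩
  obtain ⟨g, hg⟩ := Quotient.exact h.symm
  have h1 : ConjAct.ofConjAct g.1 * diagU l * (ConjAct.ofConjAct g.1)⁻¹ = diagU l := g.2
  have h2 := hirr.conj (ConjAct.ofConjAct g.1)
  rw [h1] at h2
  rw [← hg]
  exact h2

/-- If `k` conjugates `ρ'` to `ρ`, then `g⁻¹ * k * g'` fixes `diagU m` and conjugates one normalized
`B` to the other. This makes the fiber coordinate independent of all choices. -/
theorem mk_conj_eq_mk_conj {n r : ℕ} {l m : Fin r → Circle} (hlm : ∀ i j, l i = l j ↔ m i = m j)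
    {ρ ρ' : RepVar n r} (h : (⟦ρ⟧ : CharVar n r) = ⟦ρ'⟧) {g g' : U r}
    (hg : g * diagU m * g⁻¹ = ρ.1.1) (hg' : g' * diagU m * g'⁻¹ = ρ'.1.1) :
    (⟦g⁻¹ * ρ.1.2 * g⟧ : ConjQuotient l) = ⟦g'⁻¹ * ρ'.1.2 * g'⟧ := by
  obtain ⟨k, rfl⟩ := Quotient.exact h
  obtain ⟨k, rfl⟩ := ConjAct.toConjAct.surjective k
  change _ = k * ρ'.1.1 * k⁻¹ at hg
  refine Quotient.sound ⟨⟨ConjAct.toConjAct (g⁻¹ * k * g'), ?_⟩, ?_⟩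
  · rw [stab_eq_stab hlm, MulAction.mem_stabilizer_iff]
    change g⁻¹ * k * g' * diagU m * (g⁻¹ * k * g')⁻¹ = diagU m
    have : g⁻¹ * k * g' * diagU m * (g⁻¹ * k * g')⁻¹ =
      g⁻¹ * (k * (g' * diagU m * g'⁻¹) * k⁻¹) * g := by group
    rw [this, hg', ← hg]
    group
  · change g⁻¹ * k * g' * (g'⁻¹ * ρ'.1.2 * g') * (g⁻¹ * k * g')⁻¹ =
      g⁻¹ * (k * ρ'.1.2 * k⁻¹) * g
    group

/-- `hF` and `hb` only supply values outside `S`, where the total functions of a trivialization are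
irrelevant. Nonemptiness of `F` is conditional on a point of `Z`, since the fiber may be empty. -/
theorem exists_trivialization {Z B F : Type*} [TopologicalSpace Z] [TopologicalSpace B]
    [TopologicalSpace F] {proj : Z → B} {S : Set B} (hS : IsOpen S) (hproj : Continuous proj)
    (H : proj ⁻¹' S ≃ₜ S × F) (hH : ∀ x, ((H x).1 : B) = proj x) (hF : Z → Nonempty F)
    {b : B} (hb : b ∈ S) : ∃ e : Bundle.Trivialization F proj, e.baseSet = S := by
  classical
  exact ⟨{ toFun e := if he : proj e ∈ S then ⟨(H ⟨e, he⟩).1, (H ⟨e, he⟩).2⟩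
            else ⟨proj e, (hF e).some⟩
           invFun xi := H.symm (if hx : xi.1 ∈ S then ⟨xi.1, hx⟩ else ⟨b, hb⟩, xi.2)
           source := proj ⁻¹' S
           target := S ×ˢ Set.univ
           map_source' e (he : proj e ∈ S) := by simp [he]
           map_target' _ _ := Subtype.coe_prop _
           left_inv' e (he : proj e ∈ S) := by simp [he]
           right_inv' xi := by
            rintro ⟨hx, -⟩
            simpa [hx] using fun h => (h (H.symm _).2).elim
           open_source := hS.preimage hproj
           open_target := hS.prod isOpen_univ
           continuousOn_toFun := continuousOn_iff_continuous_domRestrict.mpr <|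
            ((continuous_subtype_val.prodMap continuous_id).comp H.continuous).congr
              fun ⟨e, (he : proj e ∈ S)⟩ => by simp [Prod.map, he]
           continuousOn_invFun := continuousOn_iff_continuous_domRestrict.mpr <|
            ((continuous_subtype_val.comp H.symm.continuous).comp (by fun_prop :
              Continuous fun ui => ⟨⟨_, ui.2.1⟩, ui.1.2⟩)).congr
                fun ⟨⟨x, i⟩, ⟨hx, _⟩⟩ => by simp [hx]
           baseSet := S
           open_baseSet := hS
           source_eq := rfl
           target_eq := rfl
           proj_toFun e (he : proj e ∈ S) := by simp [he, hH] }, rfl⟩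

/-! ### Configurations of equal type -/

theorem coe_config {X : Type*} {r : ℕ} (l : Fin r → X) :
    (config l : Multiset X) = Finset.univ.val.map l := rfl

theorem card_fiber_eq_count_map {α β : Type*} [DecidableEq α] [DecidableEq β] (F : Finset α)
    (g : α → β) (k : β) :
    Fintype.card {a : {x // x ∈ F} // g a = k} = (F.val.map g).count k := by
  rw [Multiset.count_map, Fintype.card_subtype,
    ← Finset.card_map (Function.Embedding.subtype fun x => x ∈ F)]
  have : Finset.map (Function.Embedding.subtype fun x => x ∈ F)
      {a : {x // x ∈ F} | g a = k} = F.filter fun a => k = g a := by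
    ext x
    simp [eq_comm, and_comm]
  rw [this]
  rfl

/-- A multiplicity-preserving bijection `e` from the distinct values of `l` to those of `s` exists
because the types agree; composing `l` with it gives `m`. -/
theorem exists_config_eq_of_multType_eq {r : ℕ} {l : Fin r → Circle} {s : Sym Circle r}
    (h : multType s = multType (config l)) :
    ∃ m : Fin r → Circle, config m = s ∧ ∀ i j, l i = l j ↔ m i = m j := by
  classical
  have hp : s.1.toFinset.val.map (fun z => s.1.count z) =
      (config l).1.toFinset.val.map (fun z => (config l).1.count z) := by
    have := congrArg Nat.Partition.parts h
    unfold multType Nat.Partition.ofSym at this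
    convert this <;> rfl
  have hk : ∀ k, Nonempty ({a : {x // x ∈ (config l).1.toFinset} // (config l).1.count a.1 = k} ≃
      {a : {x // x ∈ s.1.toFinset} // s.1.count a.1 = k}) := fun k => by
    refine Fintype.card_eq.1 ?_
    rw [card_fiber_eq_count_map (config l).1.toFinset (fun a => (config l).1.count a),
      card_fiber_eq_count_map s.1.toFinset (fun a => s.1.count a), hp]
  let e := Equiv.ofFiberEquiv fun k => (hk k).some
  have he : ∀ a, s.1.count (e a).1 = (config l).1.count a.1 := fun a =>
    Equiv.ofFiberEquiv_map (fun k => (hk k).some) a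
  have hmem : ∀ i, l i ∈ (config l).1.toFinset := fun i =>
    Multiset.mem_toFinset.2 (mem_config.2 ⟨i, rfl⟩)
  have hinj : ∀ i a, (e ⟨l i, hmem i⟩ : Circle) = e a ↔ l i = a.1 := fun i a => by
    rw [Subtype.coe_inj, e.apply_eq_iff_eq, Subtype.ext_iff]
  refine ⟨fun i => e ⟨l i, hmem i⟩, Subtype.ext (Multiset.ext.2 fun z => ?_), fun i j =>
    (hinj i ⟨l j, hmem j⟩).symm⟩
  rw [Sym.val_eq_coe, coe_config]
  by_cases hz : z ∈ s.1
  · obtain ⟨a, ha⟩ := e.surjective ⟨z, Multiset.mem_toFinset.2 hz⟩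
    obtain rfl : (e a : Circle) = z := congrArg Subtype.val ha
    have hcount : (config l).1.count a.1 = (Finset.univ.val.map l).count a.1 := rfl
    rw [he, hcount, Multiset.count_map, Multiset.count_map]
    simp only [eq_comm (a := (e a : Circle)), hinj, eq_comm (a := a.1)]
  · rw [Multiset.count_eq_zero_of_notMem hz, Multiset.count_eq_zero]
    intro h1
    obtain ⟨i, -, rfl⟩ := Multiset.mem_map.1 h1
    exact hz (Multiset.mem_toFinset.1 (e _).2)

theorem mk_conj_mem_fiber {n r : ℕ} {l m : Fin r → Circle} (hlm : ∀ i j, l i = l j ↔ m i = m j)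
    {ρ : RepVar n r} (hρ : (⟦ρ⟧ : CharVar n r) ∈ irreducibleLocus n r) {g : U r}
    (hg : g * diagU m * g⁻¹ = ρ.1.1) : (⟦g⁻¹ * ρ.1.2 * g⟧ : ConjQuotient l) ∈ Fiber l := by
  have h := (mk_mem_irreducibleLocus.1 hρ).conj g⁻¹
  rw [← hg] at h
  refine mk_mem_fiber.2 (IsIrreduciblePair.of_diagU (l := m) (fun i j => (hlm i j).1) ?_)
  convert h using 1 <;> group

/-! ### Product structure from an ordered section -/

theorem eigenvalueMap_mem_base {n r : ℕ} {σ : r.Partition} (x : Stratum n σ) :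
    eigenvalueMap n r x ∈ Base n σ := by
  obtain ⟨x, ⟨ρ, rfl, hirr⟩, hx⟩ := x
  exact ⟨hx, pow_eq_pow_of_isIrreduciblePair hirr ρ.2⟩

/-- The eigenvalue map from a stratum to its base. -/
abbrev baseMap {n r : ℕ} (σ : r.Partition) (x : Stratum n σ) : Base n σ :=
  ⟨eigenvalueMap n r x, eigenvalueMap_mem_base x⟩

theorem continuous_baseMap {n r : ℕ} (σ : r.Partition) : Continuous (baseMap (n := n) σ) :=
  (continuous_eigenvalueMap.comp continuous_subtype_val).subtype_mk _

theorem nonempty_fiber {n r : ℕ} {σ : r.Partition} {l : Fin r → Circle}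
    (hl : multType (config l) = σ) (x : Stratum n σ) : Nonempty (Fiber l) := by
  obtain ⟨x, ⟨ρ, rfl, hirr⟩, hx⟩ := x
  change multType (spec ρ.1.1) = σ at hx
  obtain ⟨m, hm, hlm⟩ := exists_config_eq_of_multType_eq (hx.trans hl.symm)
  obtain ⟨g, hg⟩ := exists_eq_conj_diagU_of_spec_eq hm.symm
  exact ⟨⟨_, mk_conj_mem_fiber hlm (mk_mem_irreducibleLocus.2 hirr) hg.symm⟩⟩

/-- The data of a continuous ordering of the configurations in `S`, compatible with the
coincidences among the entries of `l`. -/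
structure OrderedSection {n r : ℕ} {σ : r.Partition} (S : Set (Base n σ))
    (l : Fin r → Circle) where
  /-- The ordering of each configuration. -/
  toFun : S → Fin r → Circle
  continuous_toFun : Continuous toFun
  config_toFun : ∀ s, config (toFun s) = s.1.1
  eq_iff : ∀ s i j, l i = l j ↔ toFun s i = toFun s j

namespace OrderedSection

variable {n r : ℕ} {σ : r.Partition} {S : Set (Base n σ)} {l : Fin r → Circle}
  (L : OrderedSection S l)

include L in
theorem exists_conj (x : baseMap σ ⁻¹' S) : ∃ (ρ : RepVar n r) (g : U r), ⟦ρ⟧ = x.1.1 ∧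
    g * diagU (L.toFun ⟨_, x.2⟩) * g⁻¹ = ρ.1.1 := by
  obtain ⟨ρ, hρ⟩ := Quotient.exists_rep x.1.1
  have h : spec ρ.1.1 = config (L.toFun ⟨_, x.2⟩) := by
    rw [L.config_toFun]
    change _ = eigenvalueMap n r x.1.1
    rw [← hρ]
    rfl
  obtain ⟨g, hg⟩ := exists_eq_conj_diagU_of_spec_eq h
  exact ⟨ρ, g, hρ, hg.symm⟩

/-- The class in the fiber of a point over `S`. -/
def toFiber (x : baseMap σ ⁻¹' S) : Fiber l :=
  ⟨⟦(L.exists_conj x).choose_spec.choose⁻¹ * (L.exists_conj x).choose.1.2 *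
    (L.exists_conj x).choose_spec.choose⟧,
    mk_conj_mem_fiber (L.eq_iff _)
      ((L.exists_conj x).choose_spec.choose_spec.1.symm ▸ x.1.2.1)
      (L.exists_conj x).choose_spec.choose_spec.2⟩

theorem coe_toFiber (x : baseMap σ ⁻¹' S) {ρ : RepVar n r} (hρ : ⟦ρ⟧ = x.1.1) {g : U r}
    (hg : g * diagU (L.toFun ⟨_, x.2⟩) * g⁻¹ = ρ.1.1) :
    (L.toFiber x : ConjQuotient l) = ⟦g⁻¹ * ρ.1.2 * g⟧ :=
  mk_conj_eq_mk_conj (L.eq_iff _)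
    ((L.exists_conj x).choose_spec.choose_spec.1.trans hρ.symm)
    (L.exists_conj x).choose_spec.choose_spec.2 hg

/-- Diagonalizing matrices are adjoined as extra data rather than chosen: on the space `E` of pairs
`(g, ρ)` with `g` diagonalizing `ρ`, the formula `g⁻¹ * B * g` is continuous. -/
theorem continuous_toFiber : Continuous L.toFiber := by
  let q : RepVar n r → CharVar n r := Quotient.mk _
  have hq : IsOpenQuotientMap ((baseMap σ ⁻¹' S).restrictPreimage
      ((Stratum n σ).restrictPreimage q)) :=
    (MulAction.isOpenQuotientMap_quotientMk.restrictPreimage _).restrictPreimage _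
  set P := (Stratum n σ).restrictPreimage q ⁻¹' (baseMap σ ⁻¹' S)
  let f : P → baseMap σ ⁻¹' S := (baseMap σ ⁻¹' S).restrictPreimage
      ((Stratum n σ).restrictPreimage q)
  let E : Set (U r × P) :=
    {p | p.1 * diagU (L.toFun ⟨_, (f p.2).2⟩) * p.1⁻¹ = p.2.1.1.1.1}
  have hE : IsClosed E := by
    refine isClosed_eq ?_ (by fun_prop)
    refine (continuous_fst.mul (continuous_diagU.comp (L.continuous_toFun.comp ?_))).mul
      continuous_fst.inv
    exact ((continuous_baseMap σ).comp (continuous_subtype_val.comp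
      (hq.continuous.comp continuous_snd))).subtype_mk _
  let π : E → P := fun p => p.1.2
  have hπ : Continuous π := continuous_snd.comp continuous_subtype_val
  -- Since `U(r)` is compact and `E` is closed, forgetting `g` is a closed map; it is onto because
  -- every unitary matrix is diagonalizable with its spectrum in the prescribed order.
  have hπq : Topology.IsQuotientMap π := by
    refine IsClosedMap.isQuotientMap
      (isClosedMap_snd_of_compactSpace.comp hE.isClosedMap_subtype_val) hπ fun p => ?_
    have h : spec p.1.1.1.1 = config (L.toFun ⟨_, (f p).2⟩) :=
      (L.config_toFun ⟨_, (f p).2⟩).symm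
    obtain ⟨g, hg⟩ := exists_eq_conj_diagU_of_spec_eq h
    exact ⟨⟨(g, p), hg.symm⟩, rfl⟩
  rw [(hq.isQuotientMap.comp hπq).continuous_iff, continuous_induced_rng]
  have hc : Continuous fun p : E => (⟦p.1.1⁻¹ * p.1.2.1.1.1.2 * p.1.1⟧ : ConjQuotient l) :=
    continuous_quotient_mk'.comp (by fun_prop)
  exact hc.congr fun p => (L.coe_toFiber (f (π p)) rfl p.2).symm

/-- The pair formed by the diagonal matrix attached to a configuration and a unitary matrix. -/
def pair (s : S) (B : U r) : RepVar n r :=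
  ⟨(diagU (L.toFun s), B), commutator_diagU_pow (fun i j => s.1.2.2 _
    (L.config_toFun s ▸ mem_config.2 ⟨i, rfl⟩) _ (L.config_toFun s ▸ mem_config.2 ⟨j, rfl⟩)) B⟩

theorem eigenvalueMap_pair (s : S) (B : U r) : eigenvalueMap n r ⟦L.pair s B⟧ = s.1.1 :=
  (spec_diagU _).trans (L.config_toFun s)

theorem pair_mem (s : S) {B : U r} (hB : IsIrreduciblePair (diagU l) B) :
    (⟦L.pair s B⟧ : CharVar n r) ∈ Stratum n σ :=
  ⟨mk_mem_irreducibleLocus.2 (hB.of_diagU fun i j => (L.eq_iff s i j).2), by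
    rw [L.eigenvalueMap_pair]; exact s.1.2.1⟩

/-- The point over `S` with a given configuration and a given class in the fiber. -/
def ofFiber (p : S × Fiber l) : baseMap σ ⁻¹' S :=
  ⟨⟨⟦L.pair p.1 p.2.2.choose⟧, L.pair_mem p.1 p.2.2.choose_spec.2⟩, by
    have h : baseMap σ ⟨⟦L.pair p.1 p.2.2.choose⟧, L.pair_mem p.1 p.2.2.choose_spec.2⟩ = p.1.1 :=
      Subtype.ext (L.eigenvalueMap_pair _ _)
    rw [Set.mem_preimage, h]
    exact p.1.2⟩

theorem baseMap_ofFiber (p : S × Fiber l) : baseMap σ (L.ofFiber p).1 = p.1.1 :=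
  Subtype.ext (L.eigenvalueMap_pair _ _)

/-- Two representatives differ by an element of `Stab l`, which also fixes `diagU (L.toFun p.1)`, so
it conjugates the whole pair. -/
theorem coe_ofFiber (p : S × Fiber l) {B : U r} (hB : ⟦B⟧ = p.2.1) :
    (L.ofFiber p).1.1 = ⟦L.pair p.1 B⟧ := by
  have h : (⟦p.2.2.choose⟧ : ConjQuotient l) = ⟦B⟧ := p.2.2.choose_spec.1.trans hB.symm
  obtain ⟨g, hg⟩ := Quotient.exact h
  refine Quotient.sound ⟨g.1, Subtype.ext (Prod.ext ?_ hg)⟩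
  exact (stab_eq_stab (L.eq_iff p.1)).le g.2

/-- Continuity is tested on `S × U(r)`, restricted to irreducible `B`: the quotient map to the fiber
is open, so its product with the identity of `S` is still a quotient map. -/
theorem continuous_ofFiber : Continuous L.ofFiber := by
  have : ContinuousConstSMul (Stab l) (U r) :=
    ⟨fun g => continuous_const_smul (g : ConjAct (U r))⟩
  let q : U r → ConjQuotient l := Quotient.mk _
  have hq : IsOpenQuotientMap ((Fiber l).restrictPreimage q) :=
    MulAction.isOpenQuotientMap_quotientMk.restrictPreimage _
  rw [← ((IsOpenQuotientMap.id (X := S)).prodMap hq).continuous_comp_iff, continuous_induced_rng,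
    continuous_induced_rng]
  have hc : Continuous fun p : S × (q ⁻¹' Fiber l) => (⟦L.pair p.1 p.2.1⟧ : CharVar n r) :=
    continuous_quotient_mk'.comp (Continuous.subtype_mk
      ((continuous_diagU.comp (L.continuous_toFun.comp continuous_fst)).prodMk
        (continuous_subtype_val.comp continuous_snd)) _)
  exact hc.congr fun p => (L.coe_ofFiber (p.1, ⟨q p.2.1, p.2.2⟩) rfl).symm

/-- The part of the stratum over `S` is a product. -/
def homeomorph : baseMap σ ⁻¹' S ≃ₜ S × Fiber l where
  toFun x := (⟨_, x.2⟩, L.toFiber x)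
  invFun := L.ofFiber
  left_inv x := by
    obtain ⟨ρ, g, hρ, hg⟩ := L.exists_conj x
    refine Subtype.ext (Subtype.ext ?_)
    rw [L.coe_ofFiber _ (L.coe_toFiber x hρ hg).symm, ← hρ]
    refine Quotient.sound ⟨ConjAct.toConjAct g⁻¹, Subtype.ext (Prod.ext ?_ ?_)⟩
    · change g⁻¹ * ρ.1.1 * g⁻¹⁻¹ = diagU _
      rw [← hg]
      group
    · change g⁻¹ * ρ.1.2 * g⁻¹⁻¹ = g⁻¹ * ρ.1.2 * g
      rw [inv_inv]
  right_inv p := by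
    obtain ⟨B, hB, -⟩ := p.2.2
    have h1 : (⟨_, (L.ofFiber p).2⟩ : S) = p.1 := Subtype.ext (L.baseMap_ofFiber p)
    refine Prod.ext h1 (Subtype.ext ?_)
    -- The first matrix of `pair` is already diagonal in the chosen order, so `g = 1` diagonalizes
    -- it.
    rw [L.coe_toFiber (L.ofFiber p) (L.coe_ofFiber p hB).symm (g := 1), ← hB]
    · simp [pair]
    · rw [h1]
      simp [pair]
  continuous_toFun := (((continuous_baseMap σ).comp continuous_subtype_val).subtype_mk _).prodMk
    L.continuous_toFiber
  continuous_invFun := L.continuous_ofFiber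

end OrderedSection

/-! ### Zariski open sets of configurations -/

theorem exists_mvPolynomial_eval_eq_re_im_pow {r : ℕ} (i : Fin r) (k : ℕ) :
    ∃ P Q : MvPolynomial (Fin r ⊕ Fin r) ℝ, ∀ l : Fin r → Circle,
      P.eval (Sum.elim (fun i => (l i : ℂ).re) (fun i => (l i : ℂ).im)) = ((l i : ℂ) ^ k).re ∧
      Q.eval (Sum.elim (fun i => (l i : ℂ).re) (fun i => (l i : ℂ).im)) = ((l i : ℂ) ^ k).im := by
  induction k with
  | zero => exact ⟨1, 0, fun l => by simp⟩
  | succ k ih =>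
    obtain ⟨P, Q, h⟩ := ih
    refine ⟨P * .X (.inl i) - Q * .X (.inr i), P * .X (.inr i) + Q * .X (.inl i), fun l => ?_⟩
    obtain ⟨h1, h2⟩ := h l
    simp [pow_succ, h1, h2]

/-- The complement is the zero set of one real polynomial: `|z ^ n - a| ^ 2` is a sum of two
squares, and the product over the entries vanishes exactly when some entry has `n`-th power `a`. -/
theorem isZariskiOpenSym_pow_ne (r n : ℕ) (a : ℂ) :
    IsZariskiOpenSym {s : Sym Circle r | ∀ z ∈ s, (z : ℂ) ^ n ≠ a} := by
  choose P Q h using fun i : Fin r => exists_mvPolynomial_eval_eq_re_im_pow i n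
  refine ⟨{∏ i, ((P i - .C a.re) ^ 2 + (Q i - .C a.im) ^ 2)}, ?_⟩
  ext l
  have key : ∀ i, (((l i : ℂ) ^ n).re - a.re) ^ 2 + (((l i : ℂ) ^ n).im - a.im) ^ 2 = 0 ↔
      (l i : ℂ) ^ n = a := by
    intro i
    rw [Complex.ext_iff]
    constructor
    · intro h0
      constructor <;> nlinarith [sq_nonneg (((l i : ℂ) ^ n).re - a.re),
        sq_nonneg (((l i : ℂ) ^ n).im - a.im)]
    · rintro ⟨h1, h2⟩
      rw [h1, h2]
      ring
  simp only [Set.mem_compl_iff, Set.mem_preimage, Set.mem_ofPred_eq, Set.mem_singleton_iff,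
    forall_eq, map_prod, map_add, map_pow, map_sub, MvPolynomial.eval_C, (h _ l).1, (h _ l).2,
    Finset.prod_eq_zero_iff, Finset.mem_univ, true_and, key, mem_config]
  simp

theorem isOpen_pow_ne (r n : ℕ) (a : ℂ) :
    IsOpen {s : Sym Circle r | ∀ z ∈ s, (z : ℂ) ^ n ≠ a} := by
  rw [← isOpenQuotientMap_config.isQuotientMap.isOpen_preimage]
  have : config ⁻¹' {s : Sym Circle r | ∀ z ∈ s, (z : ℂ) ^ n ≠ a} =
      ⋂ i, {l : Fin r → Circle | (l i : ℂ) ^ n ≠ a} := by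
    ext l
    simp [mem_config]
  rw [this]
  exact isOpen_iInter_of_finite fun i => isOpen_ne_fun (by fun_prop) continuous_const

/-! ### Roots on the circle -/

/-- The principal branch of the `n`-th root on the circle. -/
def circleRoot (n : ℕ) (u : Circle) : Circle := Circle.exp ((u : ℂ).arg / n)

theorem circleRoot_pow {n : ℕ} (hn : 1 ≤ n) (u : Circle) : circleRoot n u ^ n = u := by
  have : (n : ℝ) ≠ 0 := by positivity
  rw [circleRoot, ← Circle.exp_natCast_mul, mul_div_cancel₀ _ this, Circle.exp_arg]

/-- The branch cut of the argument meets the circle only at `-1`. -/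
theorem continuousAt_circleRoot (n : ℕ) {u : Circle} (hu : (u : ℂ) ≠ -1) :
    ContinuousAt (circleRoot n) u := by
  have h : (u : ℂ) ∈ Complex.slitPlane := by
    rw [Complex.mem_slitPlane_iff]
    by_contra! h
    have h1 := Circle.normSq_coe u
    rw [Complex.normSq_apply, h.2] at h1
    refine hu (Complex.ext ?_ ?_)
    · simp only [Complex.neg_re, Complex.one_re]
      nlinarith [h.1]
    · simp [h.2]
  have h1 : ContinuousAt (fun u : Circle => (u : ℂ).arg) u :=
    ContinuousAt.comp (f := fun u : Circle => (u : ℂ)) (Complex.continuousAt_arg h)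
      (by fun_prop)
  exact Circle.exp.continuous.continuousAt.comp (h1.div_const _)

theorem finite_circle_pow_eq_one {n : ℕ} (hn : 1 ≤ n) : Finite {z : Circle // z ^ n = 1} := by
  refine Finite.of_injective
    (fun z => (⟨(z.1 : ℂ), (Polynomial.mem_nthRoots hn).2 (by rw [← Circle.coe_pow, z.2]; rfl)⟩ :
      {x // x ∈ Polynomial.nthRoots n (1 : ℂ)})) fun z w h => ?_
  have h' := congrArg Subtype.val h
  exact Subtype.ext (Circle.ext h')

/-! ### Continuous orderings -/

theorem config_comp_eq {X Y : Type*} {r : ℕ} {l m : Fin r → X} (h : config l = config m)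
    (f : X → Y) : config (fun i => f (l i)) = config fun i => f (m i) := by
  apply Subtype.ext
  have h1 := congrArg (fun s => Multiset.map f s.1) h
  simpa only [config, Multiset.map_map, Function.comp_def] using h1

open Classical in
/-- An ordering of a configuration with the same coincidences as `l`, if there is one. -/
def reorder {r : ℕ} (l : Fin r → Circle) (s : Sym Circle r) : Fin r → Circle :=
  if h : ∃ m : Fin r → Circle, config m = s ∧ ∀ i j, l i = l j ↔ m i = m j then h.choose else 1

theorem reorder_spec {r : ℕ} {l : Fin r → Circle} {s : Sym Circle r}
    (h : ∃ m : Fin r → Circle, config m = s ∧ ∀ i j, l i = l j ↔ m i = m j) :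
    config (reorder l s) = s ∧ ∀ i j, l i = l j ↔ reorder l s i = reorder l s j := by
  rw [reorder, dif_pos h]
  exact h.choose_spec

/-- The rotation factor `ρ` with `ρ ^ n = z ^ n`, on the branch through `w`. -/
def rotation (n : ℕ) (w z : Circle) : Circle := w * circleRoot n ((z / w) ^ n)

theorem rotation_pow {n : ℕ} (hn : 1 ≤ n) (w z : Circle) : rotation n w z ^ n = z ^ n := by
  rw [rotation, mul_pow, circleRoot_pow hn, ← mul_pow, mul_div_cancel]

theorem rotation_congr {n : ℕ} {w z z' : Circle} (h : z ^ n = z' ^ n) :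
    rotation n w z = rotation n w z' := by
  rw [rotation, rotation, div_pow, div_pow, h]

theorem continuousAt_rotation {n : ℕ} {w z : Circle} (h : (z : ℂ) ^ n ≠ -(w : ℂ) ^ n) :
    ContinuousAt (rotation n w) z := by
  have hu : (((z / w) ^ n : Circle) : ℂ) ≠ -1 := by
    intro h1
    apply h
    rw [Circle.coe_pow, Circle.coe_div, div_pow, div_eq_iff (pow_ne_zero _ w.coe_ne_zero)] at h1
    rw [h1, neg_one_mul]
  have h2 : ContinuousAt (fun z : Circle => circleRoot n ((z / w) ^ n)) z :=
    ContinuousAt.comp (f := fun z : Circle => (z / w) ^ n) (continuousAt_circleRoot n hu)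
      (by fun_prop)
  exact continuousAt_const.mul h2

/-- The tuple obtained from `t` by reordering it after rotation by `ρ⁻¹`. -/
def rotatedReorder {r : ℕ} (l : Fin r → Circle) (ρ : Circle) (t : Fin r → Circle) :
    Fin r → Circle :=
  fun i => ρ * reorder l (config fun j => ρ⁻¹ * t j) i

theorem config_rotatedReorder {r : ℕ} {l t : Fin r → Circle} (ρ : Circle)
    (h : multType (config t) = multType (config l)) :
    config (rotatedReorder l ρ t) = config t ∧
      ∀ i j, l i = l j ↔ rotatedReorder l ρ t i = rotatedReorder l ρ t j := by
  obtain ⟨m, hm, hlm⟩ := exists_config_eq_of_multType_eq h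
  -- Rotating an ordering of `t` by `ρ⁻¹` orders the rotated configuration with the same
  -- coincidences, so `reorder` does not fall back on its default.
  obtain ⟨h1, h2⟩ := reorder_spec (l := l) (s := config fun j => ρ⁻¹ * t j)
    ⟨fun j => ρ⁻¹ * m j, config_comp_eq hm _, fun i j => by rw [hlm, mul_right_inj]⟩
  refine ⟨(config_comp_eq h1 (ρ * ·)).trans ?_, fun i j => ?_⟩
  · simp
  · rw [h2, rotatedReorder, rotatedReorder, mul_right_inj]

/-- The rotated entries lie in the finite, hence discrete, set of `n`-th roots of unity, on whose
tuples the arbitrary choice `reorder` is automatically continuous. -/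
theorem continuous_rotatedReorder {T : Type*} [TopologicalSpace T] {n r : ℕ} (hn : 1 ≤ n)
    (l : Fin r → Circle) {ρ : T → Circle} {t : T → Fin r → Circle} (hρ : Continuous ρ)
    (ht : Continuous t) (h : ∀ x i, t x i ^ n = ρ x ^ n) :
    Continuous fun x => rotatedReorder l (ρ x) (t x) := by
  have := finite_circle_pow_eq_one hn
  let u : T → Fin r → {z : Circle // z ^ n = 1} := fun x i => ⟨(ρ x)⁻¹ * t x i, by
    rw [mul_pow, h, inv_pow, inv_mul_cancel]⟩
  have hu : Continuous u := by
    refine continuous_pi fun i => Continuous.subtype_mk ?_ _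
    fun_prop
  have hr : Continuous fun x => reorder l (config fun j => (u x j : Circle)) :=
    (continuous_of_discreteTopology (f := fun v : Fin r → {z : Circle // z ^ n = 1} =>
      reorder l (config fun j => (v j : Circle)))).comp hu
  exact continuous_pi fun i => hρ.mul ((continuous_apply i).comp hr)

/-- A tuple underlying a configuration. -/
def tuple {X : Type*} [TopologicalSpace X] {r : ℕ} (s : Sym X r) : Fin r → X :=
  (isOpenQuotientMap_config.surjective s).choose

theorem config_tuple {X : Type*} [TopologicalSpace X] {r : ℕ} (s : Sym X r) :
    config (tuple s) = s :=
  (isOpenQuotientMap_config.surjective s).choose_spec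

/-- The ordering of a configuration by means of the rotation of its entries to roots of unity. -/
def ordering {r : ℕ} (n : ℕ) (i₀ : Fin r) (l : Fin r → Circle) (w : Circle)
    (t : Fin r → Circle) : Fin r → Circle :=
  rotatedReorder l (rotation n w (t i₀)) t

/-- All entries share one `n`-th power, so the rotation does not depend on which entry is listed at
`i₀`. Hence the ordering descends to configurations. -/
theorem ordering_congr {n r : ℕ} {i₀ : Fin r} {l t t' : Fin r → Circle} {w : Circle}
    (h : config t = config t') (hp : ∀ z ∈ config t, ∀ z' ∈ config t, z ^ n = z' ^ n) :
    ordering n i₀ l w t = ordering n i₀ l w t' := by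
  have h1 : rotation n w (t i₀) = rotation n w (t' i₀) :=
    rotation_congr (hp _ (mem_config.2 ⟨i₀, rfl⟩) _ (h ▸ mem_config.2 ⟨i₀, rfl⟩))
  unfold ordering rotatedReorder
  rw [h1, config_comp_eq h]

theorem continuous_ordering {T : Type*} [TopologicalSpace T] {n r : ℕ} (hn : 1 ≤ n) (i₀ : Fin r)
    (l : Fin r → Circle) {w : Circle} {t : T → Fin r → Circle} (ht : Continuous t)
    (hp : ∀ x i, t x i ^ n = t x i₀ ^ n) (hw : ∀ x, (t x i₀ : ℂ) ^ n ≠ -(w : ℂ) ^ n) :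
    Continuous fun x => ordering n i₀ l w (t x) := by
  refine continuous_rotatedReorder hn l (continuous_iff_continuousAt.2 fun x => ?_) ht
    fun x i => by rw [rotation_pow hn, hp]
  exact ContinuousAt.comp (f := fun x => t x i₀) (continuousAt_rotation (hw x)) (by fun_prop)

/-- Away from the antipode of `w ^ n`, configurations in the base can be ordered continuously. -/
def orderedSection {n r : ℕ} (hn : 1 ≤ n) (i₀ : Fin r) {σ : r.Partition} {l : Fin r → Circle}
    (hl : multType (config l) = σ) (w : Circle) :
    OrderedSection (n := n) (σ := σ)
      (Subtype.val ⁻¹' {s : Sym Circle r | ∀ z ∈ s, (z : ℂ) ^ n ≠ -(w : ℂ) ^ n}) l where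
  toFun s := ordering n i₀ l w (tuple s.1.1)
  config_toFun s := (config_rotatedReorder _ (by rw [config_tuple, hl, s.1.2.1])).1.trans
    (config_tuple s.1.1)
  eq_iff s := (config_rotatedReorder _ (by rw [config_tuple, hl, s.1.2.1])).2
  continuous_toFun := by
    set S : Set (Base n σ) :=
      Subtype.val ⁻¹' {s : Sym Circle r | ∀ z ∈ s, (z : ℂ) ^ n ≠ -(w : ℂ) ^ n} with hS
    -- The choice `tuple` need not be continuous, so continuity is checked upstairs on ordered
    -- tuples, where `tuple` may be replaced by the tuple itself.
    have hq := ((isOpenQuotientMap_config (X := Circle) (r := r)).restrictPreimage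
      (Base n σ)).restrictPreimage S
    rw [← hq.continuous_comp_iff]
    have hc := continuous_ordering (T := (Base n σ).restrictPreimage config ⁻¹' S) hn i₀ l
      (w := w) (t := fun t => t.1.1) (continuous_subtype_val.comp continuous_subtype_val)
      (fun t i => t.1.2.2 _ (mem_config.2 ⟨i, rfl⟩) _ (mem_config.2 ⟨i₀, rfl⟩))
      (fun t => t.2 _ (mem_config.2 ⟨i₀, rfl⟩))
    exact hc.congr fun t => ordering_congr (config_tuple _).symm t.1.2.2

end TwistedHopf

end

theorem mainTheorem6 (n r : ℕ) (hn : 1 ≤ n) (hr : 1 ≤ r) (σ : r.Partition)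
    (l : Fin r → Circle) (hl : TwistedHopf.multType (TwistedHopf.config l) = σ) :
    ∃ h : ∀ x : TwistedHopf.Stratum n σ,
        TwistedHopf.eigenvalueMap n r x ∈ TwistedHopf.Base n σ,
      ∀ b : TwistedHopf.Base n σ,
        ∃ e : Bundle.Trivialization (TwistedHopf.Fiber l)
            (fun x : TwistedHopf.Stratum n σ =>
              (⟨TwistedHopf.eigenvalueMap n r x, h x⟩ : TwistedHopf.Base n σ)),
          b ∈ e.baseSet ∧
          ∃ V : Set (Sym Circle r), TwistedHopf.IsZariskiOpenSym V ∧
            e.baseSet = Subtype.val ⁻¹' V := by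
  refine ⟨TwistedHopf.eigenvalueMap_mem_base, fun b => ?_⟩
  obtain ⟨t, ht⟩ := TwistedHopf.isOpenQuotientMap_config.surjective b.1
  have hw : t ⟨0, hr⟩ ∈ b.1 := ht ▸ TwistedHopf.mem_config.2 ⟨_, rfl⟩
  -- Any entry of `b` serves as base point: all its entries have `n`-th power `w ^ n`, which is not
  -- `-w ^ n`. One exists because `r ≥ 1`.
  set w := t ⟨0, hr⟩
  have hb : ∀ z ∈ b.1, (z : ℂ) ^ n ≠ -(w : ℂ) ^ n := by
    intro z hz h
    have h1 := congrArg (fun u : Circle => (u : ℂ)) (b.2.2 z hz w hw)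
    simp only [Circle.coe_pow] at h1
    exact pow_ne_zero n w.coe_ne_zero (self_eq_neg.1 (h1.symm.trans h))
  obtain ⟨e, he⟩ := TwistedHopf.exists_trivialization
    ((TwistedHopf.isOpen_pow_ne r n (-(w : ℂ) ^ n)).preimage continuous_subtype_val)
    (TwistedHopf.continuous_baseMap σ)
    (TwistedHopf.orderedSection hn ⟨0, hr⟩ hl w).homeomorph (fun x => rfl)
    (TwistedHopf.nonempty_fiber hl) hb
  exact ⟨e, he ▸ hb, _, TwistedHopf.isZariskiOpenSym_pow_ne r n _, he⟩
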